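/- Let $I$ be a finite index set and, for each $i\in I$, let $\mathcal A_i$ be a unital C*-algebra (not necessarily finite-dimensional). Let $\mathcal A=\bigotimes_{i\in I}\mathcal A_i$ be their minimal (spatial) C*-tensor product: for faithful unital $*$-representations $\pi_i$ of $\mathcal A_i$ on Hilbert spaces $H_i$, it is the C*-algebra of operators on $\bigotimes_i H_i$ generated by the operators $1\otimes\cdots\otimes\pi_i(a)\otimes\cdots\otimes 1$ with $i\in I$, $a\in\mathcal A_i$ (the assertion below holds for every choice of such $\pi_i$). For each $i$ let $\tilde{\mathcal A}_i=\bigotimes_{j\ne i}\mathcal A_j$, viewed as the C*-subalgebra of $\mathcal A$ generated by $1_{\mathcal A}$ and the canonical copies of the $\mathcal A_j$ with $j\neq i$, and define seminorms on $\mathcal A$ by $$L_i(a)=2\inf\{\|a-c\| : c\in\tilde{\mathcal A}_i\},\qquad L_{qH}(a)=\max_{i\in I}L_i(a)$$ (with $L_{qH}=0$ if $I=\emptyset$). Let $M^0(\mathcal A)$ be the space of continuous linear functionals $\varphi:\mathcal A\to\mathbb C$ that vanish on $\mathbb C1_{\mathcal A}$, and let $\tilde{\mathcal A}_i^\perp\subseteq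 M^0(\mathcal A)$ be the subspace of the functionals that vanish on $\tilde{\mathcal A}_i$. For $\varphi\in M^0(\mathcal A)$ and for $\psi\in\tilde{\mathcal A}_i^\perp$ put $$\|\varphi\|_{qH}=\sup\{|\varphi(a)| : a\in\mathcal A,\ L_{qH}(a)\le 1\},\qquad \|\psi\|_i=\sup\{|\psi(a)| : a\in\mathcal A,\ L_i(a)\le 1\}.$$ **Theorem.** All these suprema are finite, and for every $\varphi\in M^0(\mathcal A)$ $$\|\varphi\|_{qH}=\inf\Big\{\sum_{i\in I}\|\varphi_i\|_i \;:\; \varphi_i\in\tilde{\mathcal A}_i^\perp\ (i\in I),\ \ \varphi=\sum_{i\in I}\varphi_i\Big\}.$$ -/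

import Mathlib

open scoped ENNReal TensorProduct InnerProductSpace ComplexOrder

namespace QuantumHamming

section HilbertTensor

variable {I : Type*} {H : I → Type*} [∀ i, NormedAddCommGroup (H i)]
  [∀ i, InnerProductSpace ℂ (H i)]

/-- The algebraic tensor product of the family `H`, as a type of its own: it carries the
inner product of the `H i`, not the projective norm that Mathlib puts on `⨂[ℂ] i, H i`. -/
def PreHilbertTensor (H : I → Type*) [∀ i, NormedAddCommGroup (H i)]
    [∀ i, InnerProductSpace ℂ (H i)] : Type _ :=
  ⨂[ℂ] i, H i

noncomputable instance : AddCommGroup (PreHilbertTensor H) :=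
  PiTensorProduct.instAddCommGroup (R := ℂ) (s := H)

noncomputable instance : Module ℂ (PreHilbertTensor H) :=
  PiTensorProduct.instModule (R := ℂ) (s := H)

/-- The elementary tensor `⨂ x i`. -/
noncomputable def tmul : MultilinearMap ℂ H (PreHilbertTensor H) :=
  PiTensorProduct.tprod ℂ

theorem exists_eq_sum (t : PreHilbertTensor H) :
    ∃ (s : Finset (∀ i, H i)) (c : (∀ i, H i) → ℂ), t = ∑ k : s, c k • tmul k.1 := by
  have h : t ∈ Submodule.span ℂ (Set.range (tmul (H := H))) := by
    have : Submodule.span ℂ (Set.range (tmul (H := H))) = ⊤ :=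
      PiTensorProduct.span_tprod_eq_top
    rw [this]; trivial
  obtain ⟨c, rfl⟩ := Finsupp.mem_span_range_iff_exists_finsupp.1 h
  exact ⟨c.support, c, (Finset.sum_coe_sort c.support fun k => c k • tmul k).symm⟩

open Classical in
/-- `1 ⊗ ⋯ ⊗ T ⊗ ⋯ ⊗ 1`, with `T` in position `i`, on the algebraic tensor product. -/
noncomputable def preSlot (i : I) (T : H i →L[ℂ] H i) :
    PreHilbertTensor H →ₗ[ℂ] PreHilbertTensor H :=
  PiTensorProduct.map
    (Function.update (fun j => (LinearMap.id : H j →ₗ[ℂ] H j)) i (T : H i →ₗ[ℂ] H i))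

open Classical in
theorem preSlot_tmul (i : I) (T : H i →L[ℂ] H i) (x : ∀ i, H i) :
    preSlot i T (tmul x) = tmul (Function.update x i (T (x i))) := by
  simp only [preSlot, tmul]
  erw [PiTensorProduct.map_tprod]
  congr 1
  ext j
  by_cases h : j = i
  · subst h; simp
  · simp [h]

theorem anti_ext {f g : PreHilbertTensor H →ₗ⋆[ℂ] ℂ} (h : ∀ z, f (tmul z) = g (tmul z)) :
    f = g := by
  ext t
  obtain ⟨s, c, rfl⟩ := exists_eq_sum t
  simp [h]

variable [Fintype I]

/-- The linear functional `⨂ z i ↦ ∏ ⟪x i, z i⟫`. -/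
noncomputable def innerFunctional (x : ∀ i, H i) : PreHilbertTensor H →ₗ[ℂ] ℂ :=
  PiTensorProduct.lift
    ((MultilinearMap.mkPiAlgebra ℂ I ℂ).compLinearMap fun i => (innerSL ℂ (x i)).toLinearMap)

theorem innerFunctional_tmul (x z : ∀ i, H i) :
    innerFunctional x (tmul z) = ∏ i, ⟪x i, z i⟫_ℂ := by
  simp only [innerFunctional, tmul]
  erw [PiTensorProduct.lift.tprod]
  simp

/-- The conjugate-linear functional `⨂ z i ↦ ∏ ⟪z i, x i⟫`. -/
noncomputable def innerAntiFunctional (x : ∀ i, H i) : PreHilbertTensor H →ₗ⋆[ℂ] ℂ where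
  toFun t := starRingEnd ℂ (innerFunctional x t)
  map_add' := by simp
  map_smul' := by simp

theorem innerAntiFunctional_tmul (x z : ∀ i, H i) :
    innerAntiFunctional x (tmul z) = ∏ i, ⟪z i, x i⟫_ℂ := by
  simp [innerAntiFunctional, innerFunctional_tmul]

/-- `⨂ x i ↦ (t ↦ ⟪t, ⨂ x i⟫)`, extended linearly. -/
noncomputable def innerMap : PreHilbertTensor H →ₗ[ℂ] (PreHilbertTensor H →ₗ⋆[ℂ] ℂ) :=
  PiTensorProduct.lift
    { toFun := innerAntiFunctional
      map_update_add' := by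
        intro _ m i x y
        refine anti_ext fun z => ?_
        simp only [LinearMap.add_apply, innerAntiFunctional_tmul]
        rw [← Finset.mul_prod_erase _ _ (Finset.mem_univ i),
          ← Finset.mul_prod_erase _ _ (Finset.mem_univ i),
          ← Finset.mul_prod_erase _ _ (Finset.mem_univ i)]
        simp only [Function.update_self, inner_add_right, add_mul]
        congr 2 <;>
        · refine Finset.prod_congr rfl fun j hj => ?_
          simp [Function.update_of_ne (Finset.ne_of_mem_erase hj)]
      map_update_smul' := by
        intro _ m i c x
        refine anti_ext fun z => ?_
        simp only [LinearMap.smul_apply, innerAntiFunctional_tmul]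
        rw [← Finset.mul_prod_erase _ _ (Finset.mem_univ i),
          ← Finset.mul_prod_erase _ _ (Finset.mem_univ i)]
        simp only [Function.update_self, inner_smul_right, smul_eq_mul, mul_assoc]
        congr 2
        refine Finset.prod_congr rfl fun j hj => ?_
        simp [Function.update_of_ne (Finset.ne_of_mem_erase hj)] }

theorem innerMap_tmul (x z : ∀ i, H i) :
    innerMap (tmul x) (tmul z) = ∏ i, ⟪z i, x i⟫_ℂ := by
  rw [← innerAntiFunctional_tmul]
  simp only [innerMap, tmul]
  erw [PiTensorProduct.lift.tprod]
  rfl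

theorem innerMap_sum (s : Finset (∀ i, H i)) (c : (∀ i, H i) → ℂ) (u v : s → ∀ i, H i) :
    innerMap (∑ k : s, c k • tmul (v k)) (∑ k : s, c k • tmul (u k)) =
      star (fun k : s => c k) ⬝ᵥ (Matrix.of fun k l : s => ∏ i, ⟪u k i, v l i⟫_ℂ).mulVec
        (fun k : s => c k) := by
  simp only [map_sum, map_smul, LinearMap.sum_apply, LinearMap.smul_apply, map_smulₛₗ,
    innerMap_tmul, dotProduct, Matrix.mulVec, Matrix.of_apply, smul_eq_mul, Pi.star_apply,
    Finset.mul_sum]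
  refine (Finset.sum_congr rfl fun k _ => Finset.sum_congr rfl fun l _ => ?_)
  simp only [RCLike.star_def]
  ring

theorem posSemidef_prod {n : Type*} [Fintype n] (M : I → Matrix n n ℂ)
    (hM : ∀ i, (M i).PosSemidef) : (Matrix.of fun k l => ∏ i, M i k l).PosSemidef := by
  classical
  suffices h : ∀ s : Finset I, (Matrix.of fun k l => ∏ i ∈ s, M i k l).PosSemidef from h _
  intro s
  induction s using Finset.induction_on with
  | empty =>
    have := Matrix.posSemidef_gram ℂ (fun _ : n => (1 : ℂ))
    have e : (Matrix.of fun k l => ∏ i ∈ (∅ : Finset I), M i k l) =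
        Matrix.gram ℂ (fun _ : n => (1 : ℂ)) := by
      ext k l
      simp
    rw [e]
    exact this
  | insert a s ha ih =>
    have := (hM a).hadamard ih
    have e : (Matrix.of fun k l => ∏ i ∈ insert a s, M i k l) =
        (M a).hadamard (Matrix.of fun k l => ∏ i ∈ s, M i k l) := by
      ext k l
      simp [Finset.prod_insert ha]
    rw [e]
    exact this

/-- The inner product determined by `⟪⨂ x i, ⨂ y i⟫ = ∏ ⟪x i, y i⟫`. -/
@[reducible]
noncomputable def innerCore : PreInnerProductSpace.Core ℂ (PreHilbertTensor H) where
  inner s t := innerMap t s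
  conj_inner_symm s t := by
    obtain ⟨S, c, rfl⟩ := exists_eq_sum s
    obtain ⟨S', c', rfl⟩ := exists_eq_sum t
    simp only [map_sum, map_smul, LinearMap.sum_apply, LinearMap.smul_apply, map_smulₛₗ,
      innerMap_tmul, smul_eq_mul, map_mul, map_prod, inner_conj_symm, Complex.conj_conj]
    simp only [Finset.mul_sum]
    rw [Finset.sum_comm]
    simp only [mul_left_comm]
  re_inner_nonneg t := by
    obtain ⟨S, c, rfl⟩ := exists_eq_sum t
    rw [innerMap_sum S c (fun k => k.1) (fun k => k.1)]
    have := (posSemidef_prod _ fun i : I =>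
      Matrix.posSemidef_gram ℂ fun k : S => k.1 i).dotProduct_mulVec_nonneg (fun k : S => c k)
    exact (RCLike.nonneg_iff.1 this).1
  add_left s s' t := by simp
  smul_left s t c := by simp

noncomputable instance : SeminormedAddCommGroup (PreHilbertTensor H) :=
  @InnerProductSpace.Core.toSeminormedAddCommGroup ℂ _ _ _ _ innerCore

noncomputable instance : InnerProductSpace ℂ (PreHilbertTensor H) :=
  InnerProductSpace.ofCore innerCore

theorem inner_tmul (x y : ∀ i, H i) :
    ⟪tmul x, tmul y⟫_ℂ = ∏ i, ⟪x i, y i⟫_ℂ :=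
  innerMap_tmul y x

/-- The Hilbert space tensor product `⨂ H i` of a finite family of Hilbert spaces: the
completion of the algebraic tensor product for `⟪⨂ x i, ⨂ y i⟫ = ∏ ⟪x i, y i⟫`. -/
abbrev HilbertTensor (H : I → Type*) [∀ i, NormedAddCommGroup (H i)]
    [∀ i, InnerProductSpace ℂ (H i)] : Type _ :=
  UniformSpace.Completion (PreHilbertTensor H)

theorem norm_preSlot_le (i : I) (T : H i →L[ℂ] H i) (t : PreHilbertTensor H) :
    ‖preSlot i T t‖ ≤ ‖T‖ * ‖t‖ := by
  classical
  obtain ⟨S, c, rfl⟩ := exists_eq_sum t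
  refine le_of_sq_le_sq ?_ (by positivity)
  rw [mul_pow]
  have e1 : preSlot i T (∑ k : S, c k • tmul k.1) =
      ∑ k : S, c k • tmul (Function.update k.1 i (T (k.1 i))) := by
    simp [preSlot_tmul]
  rw [e1, norm_sq_eq_re_inner (𝕜 := ℂ)
      (∑ k : S, c k • tmul (Function.update k.1 i (T (k.1 i)))),
    norm_sq_eq_re_inner (𝕜 := ℂ) (∑ k : S, c k • tmul k.1)]
  change RCLike.re (innerMap _ _) ≤ _ * RCLike.re (innerMap _ _)
  rw [innerMap_sum S c (fun k => k.1) (fun k => k.1),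
    innerMap_sum S c (fun k => Function.update k.1 i (T (k.1 i)))
      (fun k => Function.update k.1 i (T (k.1 i)))]
  let M : I → Matrix S S ℂ := Function.update (fun j => Matrix.gram ℂ fun k : S => k.1 j) i
    (((‖T‖ ^ 2 : ℝ) : ℂ) • Matrix.gram ℂ (fun k : S => k.1 i) -
      Matrix.gram ℂ (fun k : S => (T (k.1 i) : H i)))
  have hM : ∀ j, (M j).PosSemidef := by
    intro j
    by_cases hj : j = i
    · subst hj
      simp only [M, Function.update_self]
      refine .of_dotProduct_mulVec_nonneg ?_ fun x => ?_
      · refine Matrix.IsHermitian.sub ?_ (Matrix.isHermitian_gram ℂ _)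
        rw [Matrix.IsHermitian, Matrix.conjTranspose_smul, Matrix.isHermitian_gram ℂ _]
        simp
      · rw [Matrix.sub_mulVec, dotProduct_sub, Matrix.smul_mulVec, dotProduct_smul,
          Matrix.star_dotProduct_gram_mulVec, Matrix.star_dotProduct_gram_mulVec]
        simp only [← map_smul, ← map_sum]
        rw [inner_self_eq_norm_sq_to_K, inner_self_eq_norm_sq_to_K]
        have h := T.le_opNorm (∑ k, x k • k.1 j)
        have h2 := pow_le_pow_left₀ (norm_nonneg _) h 2
        rw [mul_pow] at h2
        simp only [smul_eq_mul, sub_nonneg]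
        have h3 := Complex.real_le_real.2 h2
        push_cast at h3 ⊢
        exact h3
    · simp only [M, Function.update_of_ne hj]
      exact Matrix.posSemidef_gram ℂ _
  have key := (RCLike.nonneg_iff.1
    ((posSemidef_prod M hM).dotProduct_mulVec_nonneg (fun k : S => c k))).1
  have e2 : (Matrix.of fun k l => ∏ j, M j k l) =
      ((‖T‖ ^ 2 : ℝ) : ℂ) • (Matrix.of fun k l : S => ∏ j, ⟪k.1 j, l.1 j⟫_ℂ) -
      Matrix.of fun k l : S => ∏ j, ⟪Function.update k.1 i (T (k.1 i)) j,
        Function.update l.1 i (T (l.1 i)) j⟫_ℂ := by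
    ext k l
    simp only [Matrix.of_apply, Matrix.sub_apply, Matrix.smul_apply]
    rw [← Finset.mul_prod_erase _ _ (Finset.mem_univ i),
      ← Finset.mul_prod_erase _ _ (Finset.mem_univ i),
      ← Finset.mul_prod_erase _ _ (Finset.mem_univ i)]
    have a1 : ∏ j ∈ Finset.univ.erase i, M j k l =
        ∏ j ∈ Finset.univ.erase i, ⟪k.1 j, l.1 j⟫_ℂ :=
      Finset.prod_congr rfl fun j hj => by
        simp [M, Function.update_of_ne (Finset.ne_of_mem_erase hj)]
    have a2 : ∏ j ∈ Finset.univ.erase i, ⟪Function.update k.1 i (T (k.1 i)) j,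
          Function.update l.1 i (T (l.1 i)) j⟫_ℂ =
        ∏ j ∈ Finset.univ.erase i, ⟪k.1 j, l.1 j⟫_ℂ :=
      Finset.prod_congr rfl fun j hj => by
        simp [Function.update_of_ne (Finset.ne_of_mem_erase hj)]
    rw [a1, a2]
    simp [M, sub_mul, mul_assoc]
  rw [e2, Matrix.sub_mulVec, dotProduct_sub, Matrix.smul_mulVec, dotProduct_smul,
    map_sub, sub_nonneg, smul_eq_mul] at key
  refine key.trans_eq ?_
  exact RCLike.re_ofReal_mul _ _

/-- The bounded operator `1 ⊗ ⋯ ⊗ T ⊗ ⋯ ⊗ 1`, with `T` in position `i`, on `⨂ H i`. -/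
noncomputable def slot (i : I) (T : H i →L[ℂ] H i) : HilbertTensor H →L[ℂ] HilbertTensor H :=
  ((preSlot i T).mkContinuous ‖T‖ (norm_preSlot_le i T)).completion

open Classical in
theorem slot_tmul (i : I) (T : H i →L[ℂ] H i) (x : ∀ i, H i) :
    slot i T (tmul x : PreHilbertTensor H) =
      (tmul (Function.update x i (T (x i))) : PreHilbertTensor H) := by
  rw [← preSlot_tmul]
  exact ContinuousLinearMap.completion_apply_coe _ _

end HilbertTensor

section Hamming

variable {I : Type*} [Fintype I] {A : I → Type*} [∀ i, CStarAlgebra (A i)]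
  {H : I → Type*} [∀ i, NormedAddCommGroup (H i)] [∀ i, InnerProductSpace ℂ (H i)]
  [∀ i, CompleteSpace (H i)] (π : ∀ i, A i →⋆ₐ[ℂ] (H i →L[ℂ] H i))

/-- The operators `1 ⊗ ⋯ ⊗ π i a ⊗ ⋯ ⊗ 1` on `⨂ H i`, for all positions `i` and all `a : A i`. -/
def generators : Set (HilbertTensor H →L[ℂ] HilbertTensor H) :=
  {T | ∃ (i : I) (a : A i), T = slot i (π i a)}

/-- The norm closure of the star algebra generated by the operators
`1 ⊗ ⋯ ⊗ π i a ⊗ ⋯ ⊗ 1`, that is, of the span of the operators `⨂ π i (a i)`. -/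
noncomputable def spatialSubalgebra :
    StarSubalgebra ℂ (HilbertTensor H →L[ℂ] HilbertTensor H) :=
  (StarAlgebra.adjoin ℂ (generators π)).topologicalClosure

instance : IsClosed (spatialSubalgebra π : Set (HilbertTensor H →L[ℂ] HilbertTensor H)) :=
  StarSubalgebra.isClosed_topologicalClosure _

/-- The minimal (spatial) C⋆-tensor product `⨂ A i` of unital C⋆-algebras that are faithfully
represented by `π i` on Hilbert spaces `H i`: the C⋆-algebra of operators on `⨂ H i` generated
by the operators `1 ⊗ ⋯ ⊗ π i a ⊗ ⋯ ⊗ 1`, with the operator norm. -/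
def MinTensor : Type _ := spatialSubalgebra π

noncomputable instance : CStarAlgebra (MinTensor π) :=
  inferInstanceAs (CStarAlgebra (spatialSubalgebra π))

/-- The canonical copy `1 ⊗ ⋯ ⊗ a ⊗ ⋯ ⊗ 1` in `⨂ A i` of an element `a` of `A i`. -/
noncomputable def embed (i : I) (a : A i) : MinTensor π :=
  ⟨slot i (π i a), StarSubalgebra.le_topologicalClosure _
    (StarAlgebra.subset_adjoin ℂ _ ⟨i, a, rfl⟩)⟩

/-- The C⋆-subalgebra `⨂_{j ≠ i} A j` of `⨂ A i`, generated by the canonical copies of the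
`A j` with `j ≠ i`. -/
noncomputable def tilde (i : I) : StarSubalgebra ℂ (MinTensor π) :=
  (StarAlgebra.adjoin ℂ {x | ∃ (j : I) (a : A j), j ≠ i ∧ x = embed π j a}).topologicalClosure

/-- `L_i(a) = 2 inf {‖a - c‖ : c ∈ ⨂_{j ≠ i} A j}`. -/
noncomputable def partialSeminorm (i : I) (a : MinTensor π) : ℝ :=
  2 * ⨅ c : tilde π i, ‖a - (c : MinTensor π)‖

/-- The quantum Hamming seminorm `L_qH(a) = max_i L_i(a)`. -/
noncomputable def hammingSeminorm (a : MinTensor π) : ℝ :=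
  ⨆ i, partialSeminorm π i a

/-- The bounded linear functionals on `⨂ A i` that vanish on the scalar multiples of `1`. -/
def M0 : Submodule ℂ (MinTensor π →L[ℂ] ℂ) where
  carrier := {φ | ∀ z : ℂ, φ (z • 1) = 0}
  add_mem' := by intro φ ψ hφ hψ z; rw [add_apply, hφ, hψ, add_zero]
  zero_mem' := by intro z; rfl
  smul_mem' := by intro c φ hφ z; rw [smul_apply, hφ, smul_zero]

/-- The annihilator of `⨂_{j ≠ i} A j` in the space `M0` of functionals. -/
def tildePerp (i : I) : Submodule ℂ (M0 π) where
  carrier := {φ | ∀ c ∈ tilde π i, (φ : MinTensor π →L[ℂ] ℂ) c = 0}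
  add_mem' := by
    intro φ ψ hφ hψ c hc
    rw [Submodule.coe_add, add_apply, hφ c hc, hψ c hc, add_zero]
  zero_mem' := by intro c _; rfl
  smul_mem' := by
    intro z φ hφ c hc
    rw [Submodule.coe_smul, smul_apply, hφ c hc, smul_zero]

/-- The dual norm `sup {|φ(a)| : L(a) ≤ 1}` of a functional with respect to a seminorm `L`, with
the value `∞` if the supremum is infinite. -/
noncomputable def dualNorm (L : MinTensor π → ℝ) (φ : M0 π) : ℝ≥0∞ :=
  ⨆ (a : MinTensor π) (_ : L a ≤ 1), ‖(φ : MinTensor π →L[ℂ] ℂ) a‖ₑ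

end Hamming

end QuantumHamming

/-! The formula is Hahn–Banach duality. Up to the factor 2, `L_i` is the quotient norm modulo `tilde
π i`, so `L_qH` is the norm pulled back along the diagonal map into the product of these quotients
with the max norm. A functional bounded by `L_qH` descends to the range of this map and extends to
the product with the same norm. The dual of a max norm is the sum of the dual norms, so the
coordinates of the extension are an optimal decomposition (`exists_decomposition`). The opposite
inequality follows from `L_i ≤ L_qH`.

The analytic point is the finiteness of the `L_qH` dual norm, which follows from `‖a - z • 1‖ ≤ ∑ i,
L_i(a)` for some scalar `z` (`exists_norm_sub_smul_one_le`). Here `z` is the value of `a` in a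
product vector state. Slicing position `i` by a unit vector `ξ i` is contractive and fixes whatever
commutes with the operators in position `i`, so it moves `a` by at most `2‖a - c‖` for each `c` in
`tilde π i`. Slicing every position turns `a` into `z • 1`, and the errors add up
(`exists_iterated_slice`). Finite orthonormal frames replace the identity, so that all sums are
finite. -/

namespace QuantumHamming

/-! ### Operators acting in a single tensor position. -/

section Slot

variable {I : Type*} {H : I → Type*} [∀ i, NormedAddCommGroup (H i)]
  [∀ i, InnerProductSpace ℂ (H i)] [Fintype I]

/-- Elementary tensors, as vectors of the completed tensor product. -/
noncomputable def elem (x : ∀ i, H i) : HilbertTensor H :=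
  ((tmul x : PreHilbertTensor H) : HilbertTensor H)

theorem inner_elem (x y : ∀ i, H i) : ⟪elem x, elem y⟫_ℂ = ∏ i, ⟪x i, y i⟫_ℂ := by
  rw [elem, elem, UniformSpace.Completion.inner_coe, inner_tmul]

open Classical in
theorem slot_elem (i : I) (T : H i →L[ℂ] H i) (x : ∀ i, H i) :
    slot i T (elem x) = elem (Function.update x i (T (x i))) :=
  slot_tmul i T x

theorem induction_elem {p : HilbertTensor H → Prop} (hc : IsClosed {x | p x})
    (h : ∀ (s : Finset (∀ i, H i)) (c : (∀ i, H i) → ℂ), p (∑ k ∈ s, c k • elem k)) (x) : p x := by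
  refine UniformSpace.Completion.induction_on x hc fun t => ?_
  obtain ⟨s, c, rfl⟩ := exists_eq_sum t
  have := h s c
  rw [← Finset.sum_coe_sort] at this
  convert this
  rw [← UniformSpace.Completion.coe_toComplL (𝕜 := ℂ)]
  simp only [map_sum, map_smul]
  rfl

theorem ext_elem {F : Type*} [NormedAddCommGroup F] [NormedSpace ℂ F]
    {S T : HilbertTensor H →L[ℂ] F} (h : ∀ x, S (elem x) = T (elem x)) : S = T := by
  ext x
  refine induction_elem (isClosed_eq S.continuous T.continuous) (fun s c => ?_) x
  simp [h]

/-- Elementary tensors have dense span. Testing against them reduces an identity of vectors to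
products of scalar inner products, such as linearity in one factor. -/
theorem ext_inner_elem {v w : HilbertTensor H} (h : ∀ x, ⟪elem x, v⟫_ℂ = ⟪elem x, w⟫_ℂ) :
    v = w := by
  refine ext_inner_left ℂ fun u => ?_
  refine induction_elem (p := fun u => ⟪u, v⟫_ℂ = ⟪u, w⟫_ℂ)
    (isClosed_eq (by fun_prop) (by fun_prop)) (fun s c => ?_) u
  simp only [sum_inner, inner_smul_left, h]

theorem norm_slot_apply_le (i : I) (T : H i →L[ℂ] H i) (v : HilbertTensor H) :
    ‖slot i T v‖ ≤ ‖T‖ * ‖v‖ := by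
  refine UniformSpace.Completion.induction_on v (isClosed_le (by fun_prop) (by fun_prop)) ?_
  intro t
  rw [slot, ContinuousLinearMap.completion_apply_coe, UniformSpace.Completion.norm_coe,
    UniformSpace.Completion.norm_coe]
  exact norm_preSlot_le i T t

theorem slot_mul (i : I) (S T : H i →L[ℂ] H i) : slot i (S * T) = slot i S * slot i T := by
  classical
  refine ext_elem fun x => ?_
  simp [slot_elem]

theorem slot_slot_apply (i : I) (S T : H i →L[ℂ] H i) (v : HilbertTensor H) :
    slot i S (slot i T v) = slot i (S * T) v := by
  rw [slot_mul, mul_apply_eq_comp]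

theorem inner_elem_update_right [DecidableEq I] (i : I) (x y : ∀ i, H i) (v : H i) :
    ⟪elem x, elem (Function.update y i v)⟫_ℂ =
      ⟪x i, v⟫_ℂ * ∏ j ∈ Finset.univ.erase i, ⟪x j, y j⟫_ℂ := by
  rw [inner_elem, ← Finset.mul_prod_erase _ _ (Finset.mem_univ i), Function.update_self]
  congr 1
  refine Finset.prod_congr rfl fun j hj => ?_
  rw [Function.update_of_ne (Finset.ne_of_mem_erase hj)]

theorem inner_elem_update_left [DecidableEq I] (i : I) (x y : ∀ i, H i) (v : H i) :
    ⟪elem (Function.update x i v), elem y⟫_ℂ =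
      ⟪v, y i⟫_ℂ * ∏ j ∈ Finset.univ.erase i, ⟪x j, y j⟫_ℂ := by
  rw [inner_elem, ← Finset.mul_prod_erase _ _ (Finset.mem_univ i), Function.update_self]
  congr 1
  refine Finset.prod_congr rfl fun j hj => ?_
  rw [Function.update_of_ne (Finset.ne_of_mem_erase hj)]

theorem slot_add (i : I) (S T : H i →L[ℂ] H i) : slot i (S + T) = slot i S + slot i T := by
  classical
  refine ext_elem fun x => ext_inner_elem fun y => ?_
  simp [slot_elem, inner_add_right, inner_elem_update_right, add_mul]

theorem slot_smul (i : I) (c : ℂ) (T : H i →L[ℂ] H i) : slot i (c • T) = c • slot i T := by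
  classical
  refine ext_elem fun x => ext_inner_elem fun y => ?_
  simp [slot_elem, inner_smul_right, inner_elem_update_right, mul_assoc]

theorem slot_zero (i : I) : slot i (0 : H i →L[ℂ] H i) = 0 := by
  simpa using slot_smul i 0 (0 : H i →L[ℂ] H i)

theorem slot_sum {ι : Type*} (i : I) (s : Finset ι) (T : ι → H i →L[ℂ] H i) :
    slot i (∑ k ∈ s, T k) = ∑ k ∈ s, slot i (T k) :=
  map_sum (⟨⟨slot i, slot_zero i⟩, slot_add i⟩ : (H i →L[ℂ] H i) →+ _) T s

theorem slot_commute {i j : I} (h : i ≠ j) (S : H i →L[ℂ] H i) (T : H j →L[ℂ] H j) :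
    Commute (slot i S) (slot j T) := by
  classical
  refine ext_elem fun x => ?_
  simp only [mul_apply_eq_comp, slot_elem, Function.update_of_ne h,
    Function.update_of_ne h.symm]
  rw [Function.update_comm h]

theorem inner_slot_left [∀ i, CompleteSpace (H i)] (i : I) (T : H i →L[ℂ] H i)
    (v w : HilbertTensor H) :
    ⟪slot i T v, w⟫_ℂ = ⟪v, slot i (star T) w⟫_ℂ := by
  classical
  have key : ∀ x y : ∀ i, H i, ⟪slot i T (elem x), elem y⟫_ℂ =
      ⟪elem x, slot i (star T) (elem y)⟫_ℂ := fun x y => by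
    rw [slot_elem, slot_elem, inner_elem_update_right, inner_elem_update_left,
      ContinuousLinearMap.star_eq_adjoint, ContinuousLinearMap.adjoint_inner_right]
  refine induction_elem (p := fun v => ⟪slot i T v, w⟫_ℂ = ⟪v, slot i (star T) w⟫_ℂ)
    (isClosed_eq (by fun_prop) (by fun_prop)) (fun s c => ?_) v
  refine induction_elem (p := fun w => ⟪slot i T (∑ k ∈ s, c k • elem k), w⟫_ℂ =
    ⟪∑ k ∈ s, c k • elem k, slot i (star T) w⟫_ℂ) (isClosed_eq (by fun_prop) (by fun_prop)) (fun s' c' => ?_) w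
  simp only [map_sum, map_smul, sum_inner, inner_sum, inner_smul_left, inner_smul_right, key]

theorem star_slot [∀ i, CompleteSpace (H i)] (i : I) (T : H i →L[ℂ] H i) :
    star (slot i T) = slot i (star T) := by
  rw [ContinuousLinearMap.star_eq_adjoint, eq_comm, ContinuousLinearMap.eq_adjoint_iff]
  intro v w
  rw [inner_slot_left, star_star]

end Slot
-- Slice maps and the distance to the scalars.
section Slice

variable {I : Type*} {H : I → Type*} [∀ i, NormedAddCommGroup (H i)]
  [∀ i, InnerProductSpace ℂ (H i)] [Fintype I]

theorem elem_update_smul [DecidableEq I] (x : ∀ i, H i) (i : I) (c : ℂ) (v : H i) :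
    elem (Function.update x i (c • v)) = c • elem (Function.update x i v) := by
  rw [elem, elem, MultilinearMap.map_update_smul, UniformSpace.Completion.coe_smul]

open InnerProductSpace in
/-- The orthogonal projection onto the span of a finite orthonormal family `e`. -/
noncomputable def frameProj {E ι : Type*} [NormedAddCommGroup E] [InnerProductSpace ℂ E]
    [Fintype ι] (e : ι → E) : E →L[ℂ] E :=
  ∑ l, rankOne ℂ (e l) (e l)

theorem inner_frameProj {E ι : Type*} [NormedAddCommGroup E] [InnerProductSpace ℂ E]
    [Fintype ι] (e : ι → E) (x y : E) :
    ⟪y, frameProj e x⟫_ℂ = ∑ l, ⟪y, e l⟫_ℂ * ⟪e l, x⟫_ℂ := by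
  simp [frameProj, mul_comm]

variable [∀ i, CompleteSpace (H i)] {ι : Type*} [Fintype ι]

open InnerProductSpace in
/-- The map `T ↦ ∑ l, |e l⟩⟨ξ| T |ξ⟩⟨e l|`, with the rank one operators acting in position `i`. -/
noncomputable def slice (i : I) (e : ι → H i) (ξ : H i)
    (T : HilbertTensor H →L[ℂ] HilbertTensor H) : HilbertTensor H →L[ℂ] HilbertTensor H :=
  ∑ l, slot i (rankOne ℂ (e l) ξ) * T * slot i (rankOne ℂ ξ (e l))

omit [∀ i, CompleteSpace (H i)] in
theorem slice_add (i : I) (e : ι → H i) (ξ : H i)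
    (S T : HilbertTensor H →L[ℂ] HilbertTensor H) :
    slice i e ξ (S + T) = slice i e ξ S + slice i e ξ T := by
  simp [slice, mul_add, add_mul, Finset.sum_add_distrib]

theorem star_rankOne {E : Type*} [NormedAddCommGroup E] [InnerProductSpace ℂ E] [CompleteSpace E]
    (x y : E) : star (InnerProductSpace.rankOne ℂ x y) = InnerProductSpace.rankOne ℂ y x := by
  rw [ContinuousLinearMap.star_eq_adjoint, InnerProductSpace.adjoint_rankOne]

theorem rankOne_mul_rankOne {E : Type*} [NormedAddCommGroup E] [InnerProductSpace ℂ E]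
    (x y z w : E) : InnerProductSpace.rankOne ℂ x y * InnerProductSpace.rankOne ℂ z w =
      ⟪y, z⟫_ℂ • InnerProductSpace.rankOne ℂ x w := by
  ext v
  simp [smul_smul, mul_comm]

-- Pulling `c` out leaves `|e l⟩⟨ξ|ξ⟩⟨e l|`, whose sum is the frame projection. Hence the slice
-- agrees with `c` on vectors fixed by that projection.
omit [∀ i, CompleteSpace (H i)] in
theorem slice_of_commute (i : I) (e : ι → H i) {ξ : H i} (hξ : ‖ξ‖ = 1)
    {c : HilbertTensor H →L[ℂ] HilbertTensor H} (hc : ∀ T : H i →L[ℂ] H i, Commute c (slot i T)) :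
    slice i e ξ c = c * slot i (frameProj e) := by
  rw [slice, frameProj, slot_sum, Finset.mul_sum]
  refine Finset.sum_congr rfl fun l _ => ?_
  rw [← (hc _).eq, mul_assoc, ← slot_mul, rankOne_mul_rankOne, inner_self_eq_norm_sq_to_K, hξ]
  simp

/-- The bound on `T` is required only at the vectors `u l v`, so that an estimate known only on
`frameFixed` can be fed back in when slices are iterated. -/
theorem norm_slice_apply_le (i : I) {e : ι → H i} (he : Orthonormal ℂ e) {ξ : H i} (hξ : ‖ξ‖ = 1)
    {T : HilbertTensor H →L[ℂ] HilbertTensor H} {ε : ℝ} (hε : 0 ≤ ε) {v : HilbertTensor H}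
    (hv : slot i (frameProj e) v = v)
    (hT : ∀ l, ‖T (slot i (InnerProductSpace.rankOne ℂ ξ (e l)) v)‖ ≤
      ε * ‖slot i (InnerProductSpace.rankOne ℂ ξ (e l)) v‖) :
    ‖slice i e ξ T v‖ ≤ ε * ‖v‖ := by
  classical
  set u : ι → HilbertTensor H →L[ℂ] HilbertTensor H :=
    fun l => slot i (InnerProductSpace.rankOne ℂ ξ (e l)) with hu
  set p := slot i (InnerProductSpace.rankOne ℂ ξ ξ) with hp
  -- Orthonormality of `e` removes the off-diagonal terms.
  have h1 : ⟪slice i e ξ T v, slice i e ξ T v⟫_ℂ = ∑ l, ⟪T (u l v), p (T (u l v))⟫_ℂ := by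
    simp only [slice, sum_apply, sum_inner, inner_sum, mul_apply_eq_comp]
    refine Finset.sum_congr rfl fun l _ => ?_
    rw [Finset.sum_eq_single l]
    · rw [inner_slot_left, star_rankOne, slot_slot_apply, rankOne_mul_rankOne,
        inner_self_eq_norm_sq_to_K, he.1]
      simp [hu, hp]
    · intro m _ hm
      rw [inner_slot_left, star_rankOne, slot_slot_apply, rankOne_mul_rankOne,
        he.2 hm]
      simp [slot_zero]
    · simp
  -- Pythagoras: `∑ l, star (u l) * u l` is the frame projection in position `i`, which fixes `v`.
  have h2 : ⟪v, v⟫_ℂ = ∑ l, ⟪u l v, u l v⟫_ℂ := by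
    trans ⟪v, slot i (frameProj e) v⟫_ℂ
    · rw [hv]
    rw [frameProj, slot_sum, sum_apply, inner_sum]
    refine Finset.sum_congr rfl fun l _ => ?_
    rw [inner_slot_left, star_rankOne, slot_slot_apply, rankOne_mul_rankOne,
      inner_self_eq_norm_sq_to_K, hξ]
    simp
  refine le_of_sq_le_sq ?_ (by positivity)
  rw [mul_pow, ← inner_self_eq_norm_sq (𝕜 := ℂ), ← inner_self_eq_norm_sq (𝕜 := ℂ), h1, h2,
    map_sum, map_sum, Finset.mul_sum]
  refine Finset.sum_le_sum fun l _ => ?_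
  have hpn : ‖p (T (u l v))‖ ≤ ‖T (u l v)‖ := by
    simpa [hξ] using norm_slot_apply_le i (InnerProductSpace.rankOne ℂ ξ ξ) (T (u l v))
  calc RCLike.re ⟪T (u l v), p (T (u l v))⟫_ℂ ≤ ‖T (u l v)‖ * ‖p (T (u l v))‖ :=
        (RCLike.re_le_norm _).trans (norm_inner_le_norm _ _)
    _ ≤ ‖T (u l v)‖ * ‖T (u l v)‖ := by gcongr
    _ ≤ (ε * ‖u l v‖) * (ε * ‖u l v‖) := by gcongr <;> exact hT l
    _ = ε ^ 2 * RCLike.re ⟪u l v, u l v⟫_ℂ := by rw [inner_self_eq_norm_sq]; ring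

/-- In matrix entries, slicing replaces the `i`-th coordinate of both tensors by `ξ`; this allows
the iterated slice to be computed explicitly. -/
theorem inner_elem_slice_elem [DecidableEq I] (i : I) (e : ι → H i) (ξ : H i)
    (T : HilbertTensor H →L[ℂ] HilbertTensor H) (x y : ∀ i, H i) :
    ⟪elem y, slice i e ξ T (elem x)⟫_ℂ = ⟪y i, frameProj e (x i)⟫_ℂ *
      ⟪elem (Function.update y i ξ), T (elem (Function.update x i ξ))⟫_ℂ := by
  rw [inner_frameProj, Finset.sum_mul, slice, sum_apply, inner_sum]
  refine Finset.sum_congr rfl fun l _ => ?_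
  rw [mul_apply_eq_comp, mul_apply_eq_comp, ← star_rankOne, ← inner_slot_left]
  have hs : ∀ z : ∀ i, H i, slot i (InnerProductSpace.rankOne ℂ ξ (e l)) (elem z) =
      ⟪e l, z i⟫_ℂ • elem (Function.update z i ξ) := fun z => by
    rw [slot_elem, InnerProductSpace.rankOne_apply, ← elem_update_smul]
    congr!
  simp only [hs, map_smul, inner_smul_left,
    inner_smul_right, inner_conj_symm]
  ring

/-- The vectors that are fixed by the projections of the frames `e i`. -/
def frameFixed {n : I → ℕ} (e : ∀ i, Fin (n i) → H i) : Set (HilbertTensor H) :=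
  {v | ∀ i, slot i (frameProj (e i)) v = v}

omit [∀ i, CompleteSpace (H i)] in
theorem slot_rankOne_mem_frameFixed {n : I → ℕ} {e : ∀ i, Fin (n i) → H i} {i : I} {ξ : H i}
    (hξ : frameProj (e i) ξ = ξ) (x : H i) {v : HilbertTensor H} (hv : v ∈ frameFixed e) :
    slot i (InnerProductSpace.rankOne ℂ ξ x) v ∈ frameFixed e := by
  intro j
  by_cases h : j = i
  · subst h
    rw [slot_slot_apply]
    congr 2
    ext z
    simp [hξ]
  · rw [← mul_apply_eq_comp, (slot_commute h _ _).eq, mul_apply_eq_comp, hv j]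

/-- Iterating the slices over the positions in `S` moves an operator that is close to the
commutants of all positions only a little, on the vectors fixed by the frames. -/
theorem exists_iterated_slice [DecidableEq I] {n : I → ℕ} {e : ∀ i, Fin (n i) → H i}
    (he : ∀ i, Orthonormal ℂ (e i)) {ξ : ∀ i, H i} (hξ : ∀ i, ‖ξ i‖ = 1)
    (hξe : ∀ i, frameProj (e i) (ξ i) = ξ i) (a : HilbertTensor H →L[ℂ] HilbertTensor H)
    (c : I → HilbertTensor H →L[ℂ] HilbertTensor H)
    (hc : ∀ i (T : H i →L[ℂ] H i), Commute (c i) (slot i T)) (S : Finset I) :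
    ∃ b : HilbertTensor H →L[ℂ] HilbertTensor H,
      (∀ x y, ⟪elem y, b (elem x)⟫_ℂ = (∏ i ∈ S, ⟪y i, frameProj (e i) (x i)⟫_ℂ) *
        ⟪elem (S.piecewise ξ y), a (elem (S.piecewise ξ x))⟫_ℂ) ∧
      ∀ v ∈ frameFixed e, ‖(b - a) v‖ ≤ (∑ i ∈ S, 2 * ‖a - c i‖) * ‖v‖ := by
  induction S using Finset.induction_on with
  | empty => exact ⟨a, by simp, by simp⟩
  | insert i S hi ih =>
    obtain ⟨b, hb, hb'⟩ := ih
    refine ⟨slice i (e i) (ξ i) b, fun x y => ?_, fun v hv => ?_⟩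
    · rw [inner_elem_slice_elem, hb, Finset.prod_insert hi, mul_assoc,
        Finset.piecewise_insert, Finset.piecewise_insert, Finset.update_piecewise_of_notMem _ _ _ hi,
        Finset.update_piecewise_of_notMem _ _ _ hi]
      congr 2
      refine Finset.prod_congr rfl fun j hj => ?_
      have : j ≠ i := fun h => hi (h ▸ hj)
      rw [Function.update_of_ne this, Function.update_of_ne this]
    -- Since the slice fixes `c i` at `v`, the error splits into the sliced old error and two terms
    -- of size at most `‖a - c i‖ * ‖v‖`; hence the factor 2.
    · have e1 : (slice i (e i) (ξ i) b - a) v = slice i (e i) (ξ i) (b - a) v +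
          slice i (e i) (ξ i) (a - c i) v - (a - c i) v := by
        have h1 := slice_add i (e i) (ξ i) (b - a) (a - c i)
        have h2 := slice_add i (e i) (ξ i) (b - c i) (c i)
        have h3 : slice i (e i) (ξ i) (c i) v = c i v := by
          rw [slice_of_commute i (e i) (hξ i) (hc i), mul_apply_eq_comp, hv i]
        rw [sub_add_sub_cancel] at h1
        rw [sub_add_cancel, h1] at h2
        rw [h2]
        simp only [sub_apply, add_apply, h3]
        abel
      have e2 := norm_slice_apply_le i (he i) (hξ i) (T := b - a)
        (ε := ∑ i ∈ S, 2 * ‖a - c i‖) (by positivity) (hv i)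
        fun l => hb' _ (slot_rankOne_mem_frameFixed (hξe i) _ hv)
      have e3 := norm_slice_apply_le i (he i) (hξ i) (T := a - c i) (norm_nonneg _) (hv i)
        fun l => (a - c i).le_opNorm _
      have e4 := (a - c i).le_opNorm v
      rw [e1, Finset.sum_insert hi, add_mul]
      refine (norm_sub_le _ _).trans ((add_le_add_left (norm_add_le _ _) _).trans ?_)
      linarith

theorem norm_sub_vectorState_apply_le {ξ : ∀ i, H i} (hξ : ∀ i, ‖ξ i‖ = 1)
    (a : HilbertTensor H →L[ℂ] HilbertTensor H)
    (c : I → HilbertTensor H →L[ℂ] HilbertTensor H)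
    (hc : ∀ i (T : H i →L[ℂ] H i), Commute (c i) (slot i T))
    (s : Finset (∀ i, H i)) (α : (∀ i, H i) → ℂ) :
    ‖a (∑ k ∈ s, α k • elem k) - ⟪elem ξ, a (elem ξ)⟫_ℂ • ∑ k ∈ s, α k • elem k‖ ≤
      (∑ i, 2 * ‖a - c i‖) * ‖∑ k ∈ s, α k • elem k‖ := by
  classical
  -- Only finitely many coordinate vectors occur, so finite-dimensional spaces contain them all; `ξ`
  -- is included so that slicing preserves `frameFixed`.
  let F : ∀ i, Submodule ℂ (H i) := fun i =>
    Submodule.span ℂ ((insert ξ s).image fun k => k i : Finset (H i))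
  have hF : ∀ i, ∀ k ∈ insert ξ s, k i ∈ F i := fun i k hk =>
    Submodule.subset_span (Finset.mem_coe.2 (Finset.mem_image_of_mem _ hk))
  let e : ∀ i, Fin (Module.finrank ℂ (F i)) → H i := fun i l => (stdOrthonormalBasis ℂ (F i) l : H i)
  have he : ∀ i, Orthonormal ℂ (e i) := fun i =>
    (stdOrthonormalBasis ℂ (F i)).orthonormal.comp_linearIsometry (F i).subtypeₗᵢ
  have hP : ∀ i, ∀ x ∈ F i, frameProj (e i) x = x := fun i x hx => by
    have := congrArg (Subtype.val) ((stdOrthonormalBasis ℂ (F i)).sum_repr' ⟨x, hx⟩)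
    simpa [frameProj, e] using this
  have hP' : ∀ i, ∀ k ∈ insert ξ s, frameProj (e i) (k i) = k i := fun i k hk =>
    hP i _ (hF i k hk)
  obtain ⟨b, hb, hb'⟩ := exists_iterated_slice he hξ
    (fun i => hP' i ξ (Finset.mem_insert_self _ _)) a c hc Finset.univ
  have hv : (∑ k ∈ s, α k • elem k) ∈ frameFixed e := by
    intro i
    rw [map_sum]
    refine Finset.sum_congr rfl fun k hk => ?_
    rw [map_smul, slot_elem, hP' i k (Finset.mem_insert_of_mem hk), Function.update_eq_self]
  -- After slicing every position, each matrix entry is `⟪y, x⟫` times the vector state of `a`.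
  have hbv : b (∑ k ∈ s, α k • elem k) = ⟪elem ξ, a (elem ξ)⟫_ℂ • ∑ k ∈ s, α k • elem k := by
    rw [map_sum, Finset.smul_sum]
    refine Finset.sum_congr rfl fun k hk => ?_
    rw [map_smul, smul_comm]
    congr 1
    refine ext_inner_elem fun y => ?_
    rw [hb, Finset.piecewise_univ, Finset.piecewise_univ, inner_smul_right, inner_elem, mul_comm]
    congr 1
    refine Finset.prod_congr rfl fun i _ => ?_
    rw [hP' i k (Finset.mem_insert_of_mem hk)]
  have := hb' _ hv
  rwa [sub_apply, hbv, norm_sub_rev] at this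

theorem norm_sub_vectorState_le {ξ : ∀ i, H i} (hξ : ∀ i, ‖ξ i‖ = 1)
    (a : HilbertTensor H →L[ℂ] HilbertTensor H)
    (c : I → HilbertTensor H →L[ℂ] HilbertTensor H)
    (hc : ∀ i (T : H i →L[ℂ] H i), Commute (c i) (slot i T)) :
    ‖a - ⟪elem ξ, a (elem ξ)⟫_ℂ • (1 : HilbertTensor H →L[ℂ] HilbertTensor H)‖ ≤
      ∑ i, 2 * ‖a - c i‖ := by
  refine ContinuousLinearMap.opNorm_le_bound _ (by positivity) fun v => ?_
  rw [sub_apply, smul_apply, one_apply_eq_self]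
  exact induction_elem
    (p := fun v => ‖a v - ⟪elem ξ, a (elem ξ)⟫_ℂ • v‖ ≤ (∑ i, 2 * ‖a - c i‖) * ‖v‖)
    (isClosed_le (a.continuous.sub (continuous_const_smul _)).norm
      (continuous_const.mul continuous_norm))
    (norm_sub_vectorState_apply_le hξ a c hc) v

end Slice
-- Hahn–Banach duality for a maximum of quotient norms.
section Duality

/-- The coordinates can be chosen independently, so suprema commute with the finite sum. This turns
a bound for all families of test elements into a bound on the sum of dual norms. -/
theorem sum_iSup_le {I : Type*} [Fintype I] {α : I → Type*} [∀ i, Nonempty (α i)]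
    (f : ∀ i, α i → ℝ≥0∞) {C : ℝ≥0∞} (h : ∀ a : ∀ i, α i, ∑ i, f i (a i) ≤ C) :
    ∑ i, ⨆ a, f i a ≤ C := by
  classical
  suffices H : ∀ S : Finset I, ∑ i ∈ S, ⨆ a, f i a ≤ ⨆ a : ∀ i, α i, ∑ i ∈ S, f i (a i) from
    (H _).trans (iSup_le h)
  intro S
  induction S using Finset.induction_on with
  | empty => simp
  | insert i S hi ih =>
    rw [Finset.sum_insert hi]
    refine (add_le_add_right ih _).trans (ENNReal.iSup_add_iSup_le fun b a => ?_)
    refine le_trans (le_of_eq ?_) (le_iSup _ (Function.update a i b))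
    rw [Finset.sum_insert hi, Function.update_self]
    congr 1
    refine Finset.sum_congr rfl fun j hj => ?_
    rw [Function.update_of_ne (ne_of_mem_of_not_mem hj hi)]

/-- A functional that is bounded by the maximum of the quotient norms modulo the subspaces `V i`
is a sum of functionals vanishing on the `V i`, and the sum is norm-optimal. -/
theorem exists_decomposition {I X : Type*} [Fintype I] [NormedAddCommGroup X] [NormedSpace ℂ X]
    (V : I → Submodule ℂ X) (φ : X →L[ℂ] ℂ) {K : ℝ} (hK : 0 ≤ K)
    (h : ∀ a, ‖φ a‖ ≤ K * ‖fun i => (V i).mkQ a‖) :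
    ∃ ψ : I → X →L[ℂ] ℂ, (∀ i, ∀ c ∈ V i, ψ i c = 0) ∧ φ = ∑ i, ψ i ∧
      ∀ a : I → X, ∑ i, ‖ψ i (a i)‖ ≤ K * ‖fun i => (V i).mkQ (a i)‖ := by
  classical
  let J : X →ₗ[ℂ] ∀ i, X ⧸ V i := LinearMap.pi fun i => (V i).mkQ
  have hker : LinearMap.ker J ≤ LinearMap.ker (φ : X →ₗ[ℂ] ℂ) := by
    intro a ha
    have h1 := h a
    change ‖φ a‖ ≤ K * ‖J a‖ at h1
    rw [LinearMap.mem_ker.1 ha, norm_zero, mul_zero] at h1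
    exact norm_le_zero_iff.1 h1
  let f₀ : LinearMap.range J →ₗ[ℂ] ℂ :=
    (LinearMap.ker J).liftQ (φ : X →ₗ[ℂ] ℂ) hker ∘ₗ (J.quotKerEquivRange.symm : _ →ₗ[ℂ] _)
  have hf₀ : ∀ a, f₀ ⟨J a, LinearMap.mem_range_self J a⟩ = φ a := fun a => by
    simp only [f₀, LinearMap.comp_apply, LinearEquiv.coe_coe]
    erw [LinearMap.quotKerEquivRange_symm_apply_image J a]
    simp
  have hb : ∀ y, ‖f₀ y‖ ≤ K * ‖y‖ := by
    rintro ⟨_, a, rfl⟩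
    rw [hf₀]
    exact h a
  -- Hahn–Banach extends the functional from the diagonal range to the whole product.
  obtain ⟨F, hF, hFn⟩ := exists_extension_norm_eq (LinearMap.range J) (f₀.mkContinuous K hb)
  have hFK : ‖F‖ ≤ K := hFn.trans_le (f₀.mkContinuous_norm_le hK hb)
  let ψ : I → X →L[ℂ] ℂ := fun i =>
    ((F : (∀ i, X ⧸ V i) →ₗ[ℂ] ℂ) ∘ₗ LinearMap.single ℂ _ i ∘ₗ (V i).mkQ).mkContinuous ‖F‖ <| by
      intro a
      refine (F.le_opNorm _).trans ?_
      gcongr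
      refine (pi_norm_le_iff_of_nonneg (norm_nonneg a)).2 fun j => ?_
      simp only [LinearMap.comp_apply, LinearMap.coe_single]
      by_cases hj : j = i
      · subst hj
        rw [Pi.single_eq_same]
        exact Submodule.Quotient.norm_mk_le (V j) a
      · rw [Pi.single_eq_of_ne hj, norm_zero]
        exact norm_nonneg a
  have hψ : ∀ i a, ψ i a = F (Pi.single i ((V i).mkQ a)) := fun i a => rfl
  have hsum : ∀ y : ∀ i, X ⧸ V i, ∑ i, F (Pi.single i (y i)) = F y := fun y => by
    rw [← map_sum, Finset.univ_sum_single]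
  refine ⟨ψ, fun i c hc => ?_, ?_, fun a => ?_⟩
  · rw [hψ, Submodule.mkQ_apply, (Submodule.Quotient.mk_eq_zero _).2 hc, Pi.single_zero, map_zero]
  · ext a
    rw [sum_apply]
    simp only [hψ]
    rw [hsum fun i => (V i).mkQ a, ← hf₀ a]
    exact (hF ⟨J a, LinearMap.mem_range_self J a⟩).symm
  -- Unimodular phases make all terms nonnegative, so their sum is a single value of `F`; the phases
  -- do not change the max norm.
  · choose u hu hu' using fun i => RCLike.exists_norm_eq_mul_self (K := ℂ) (ψ i (a i))
    have e : ((∑ i, ‖ψ i (a i)‖ : ℝ) : ℂ) = F fun i => u i • (V i).mkQ (a i) := by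
      rw [← hsum, Complex.ofReal_sum]
      refine Finset.sum_congr rfl fun i _ => ?_
      rw [Pi.single_smul, map_smul, ← hψ, smul_eq_mul]
      exact hu' i
    have e2 : ∑ i, ‖ψ i (a i)‖ = ‖F fun i => u i • (V i).mkQ (a i)‖ := by
      rw [← e, Complex.norm_real, Real.norm_of_nonneg (by positivity)]
    rw [e2]
    refine (F.le_opNorm _).trans (mul_le_mul hFK (le_of_eq ?_) (norm_nonneg _) hK)
    simp only [Pi.norm_def, nnnorm_smul]
    congr 2
    ext i
    have : ‖u i‖₊ = 1 := NNReal.eq (hu i)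
    rw [this, one_mul]

end Duality

/-! ### The Hamming seminorm and the duality formula. -/

section Hamming

variable {I : Type*} [Fintype I] {A : I → Type*} [∀ i, CStarAlgebra (A i)]
  {H : I → Type*} [∀ i, NormedAddCommGroup (H i)] [∀ i, InnerProductSpace ℂ (H i)]
  [∀ i, CompleteSpace (H i)] (π : ∀ i, A i →⋆ₐ[ℂ] (H i →L[ℂ] H i))

/-- The inclusion of the spatial tensor product in the bounded operators. -/
noncomputable def toOperator :
    MinTensor π →⋆ₐ[ℂ] (HilbertTensor H →L[ℂ] HilbertTensor H) :=
  (spatialSubalgebra π).subtype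

theorem norm_toOperator (a : MinTensor π) : ‖toOperator π a‖ = ‖a‖ := rfl

theorem continuous_toOperator : Continuous (toOperator π) := continuous_subtype_val

/-- The centralizer of `slot i T` and its adjoint is a closed star subalgebra containing every
generator in a position `j ≠ i`. -/
theorem commute_toOperator_slot {i : I} {c : MinTensor π} (hc : c ∈ tilde π i)
    (T : H i →L[ℂ] H i) : Commute (toOperator π c) (slot i T) := by
  let Z : StarSubalgebra ℂ (MinTensor π) :=
    (StarSubalgebra.centralizer ℂ {slot i T}).comap (toOperator π)
  have hZ : tilde π i ≤ Z := by
    refine StarSubalgebra.topologicalClosure_minimal (StarAlgebra.adjoin_le ?_) ?_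
    · rintro _ ⟨j, a, hj, rfl⟩
      change toOperator π (embed π j a) ∈ StarSubalgebra.centralizer ℂ {slot i T}
      rw [StarSubalgebra.mem_centralizer_iff]
      rintro _ rfl
      rw [star_slot]
      exact ⟨slot_commute hj.symm _ _, slot_commute hj.symm _ _⟩
    · exact (Set.isClosed_centralizer _).preimage (continuous_toOperator π)
  have h : toOperator π c ∈ StarSubalgebra.centralizer ℂ {slot i T} := hZ hc
  exact ((StarSubalgebra.mem_centralizer_iff ℂ).1 h _ rfl).1.symm

theorem partialSeminorm_eq (i : I) (a : MinTensor π) :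
    partialSeminorm π i a = 2 * ‖(Subalgebra.toSubmodule (tilde π i).toSubalgebra).mkQ a‖ := by
  rw [partialSeminorm]
  congr 1
  refine Eq.trans ?_ (QuotientAddGroup.norm_mk (S := (Subalgebra.toSubmodule
    (tilde π i).toSubalgebra).toAddSubgroup) a).symm
  rw [Metric.infDist_eq_iInf]
  simp only [dist_eq_norm]
  rfl

theorem partialSeminorm_nonneg (i : I) (a : MinTensor π) : 0 ≤ partialSeminorm π i a := by
  rw [partialSeminorm_eq]; positivity

theorem partialSeminorm_le_hammingSeminorm (i : I) (a : MinTensor π) :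
    partialSeminorm π i a ≤ hammingSeminorm π a :=
  le_ciSup (f := fun i => partialSeminorm π i a) (Set.finite_range _).bddAbove i

theorem hammingSeminorm_eq (a : MinTensor π) : hammingSeminorm π a =
    2 * ‖fun i => (Subalgebra.toSubmodule (tilde π i).toSubalgebra).mkQ a‖ := by
  -- For empty `I` the real supremum is 0, which is why the upper bound must be shown nonnegative.
  refine le_antisymm (Real.iSup_le (fun i => ?_) (by positivity)) ?_
  · rw [partialSeminorm_eq]
    gcongr
    exact norm_le_pi_norm (fun i => (Subalgebra.toSubmodule (tilde π i).toSubalgebra).mkQ a) i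
  · rw [← le_div_iff₀' two_pos, pi_norm_le_iff_of_nonneg (div_nonneg
      (show 0 ≤ hammingSeminorm π a from Real.iSup_nonneg fun i => partialSeminorm_nonneg π i a)
      two_pos.le)]
    intro i
    rw [le_div_iff₀' two_pos, ← partialSeminorm_eq]
    exact partialSeminorm_le_hammingSeminorm π i a

theorem hammingSeminorm_nonneg (a : MinTensor π) : 0 ≤ hammingSeminorm π a := by
  rw [hammingSeminorm_eq]; positivity

theorem hammingSeminorm_smul (z : ℂ) (a : MinTensor π) :
    hammingSeminorm π (z • a) = ‖z‖ * hammingSeminorm π a := by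
  rw [hammingSeminorm_eq, hammingSeminorm_eq, mul_left_comm, ← norm_smul]
  congr 2

theorem exists_tilde_norm_sub_lt (i : I) (a : MinTensor π) {ε : ℝ} (hε : 0 < ε) :
    ∃ c ∈ tilde π i, 2 * ‖a - c‖ < partialSeminorm π i a + ε := by
  obtain ⟨c, hc⟩ := exists_lt_of_ciInf_lt (f := fun c : tilde π i => ‖a - (c : MinTensor π)‖)
    (lt_add_of_pos_right _ (half_pos hε))
  refine ⟨c, c.2, ?_⟩
  rw [partialSeminorm]
  linarith

theorem exists_norm_sub_smul_one_le (a : MinTensor π) :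
    ∃ z : ℂ, ‖a - z • (1 : MinTensor π)‖ ≤ ∑ i, partialSeminorm π i a := by
  classical
  by_cases hH : ∀ i, Nontrivial (H i)
  · choose ξ hξ using fun i => exists_norm_eq (H i) zero_le_one
    refine ⟨⟪elem ξ, toOperator π a (elem ξ)⟫_ℂ, le_of_forall_pos_le_add fun ε hε => ?_⟩
    -- The `card I` errors total at most `ε`; the `+ 1` keeps the denominator positive for empty
    -- `I`.
    have hε' : 0 < ε / (Fintype.card I + 1) := by positivity
    choose c hc hc' using fun i => exists_tilde_norm_sub_lt π i a hε'
    have key := norm_sub_vectorState_le hξ (toOperator π a) (fun i => toOperator π (c i))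
      fun i T => commute_toOperator_slot π (hc i) T
    rw [← norm_toOperator, map_sub, map_smul, map_one]
    refine key.trans ?_
    calc ∑ i, 2 * ‖toOperator π a - toOperator π (c i)‖
        ≤ ∑ i, (partialSeminorm π i a + ε / (Fintype.card I + 1)) :=
          Finset.sum_le_sum fun i _ => by
            rw [← map_sub, norm_toOperator]; exact (hc' i).le
      _ ≤ _ := by
          rw [Finset.sum_add_distrib, Finset.sum_const, Finset.card_univ, nsmul_eq_mul]
          gcongr
          rw [← mul_div_assoc, div_le_iff₀ (by positivity)]
          nlinarith
  -- If some `H i` is zero there is no unit vector, but then the tensor product is zero and so is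
  -- every operator on it.
  · obtain ⟨i, hi⟩ := not_forall.1 hH
    rw [not_nontrivial_iff_subsingleton] at hi
    refine ⟨0, le_of_eq_of_le ?_ (Finset.sum_nonneg fun i _ => partialSeminorm_nonneg π i a)⟩
    rw [zero_smul, sub_zero, ← norm_toOperator, norm_eq_zero]
    refine ext_elem fun x => ?_
    have : elem x = (0 : HilbertTensor H) := by
      rw [elem, MultilinearMap.map_coord_zero _ i (Subsingleton.elim _ _)]
      rfl
    rw [this, map_zero, map_zero]

/-- As `φ` kills scalars, it sees only the distance from `a` to `ℂ1`, which is at most `card I` on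
the unit ball of `L_qH`. -/
theorem dualNorm_hammingSeminorm_lt_top (φ : M0 π) :
    dualNorm π (hammingSeminorm π) φ < ⊤ := by
  refine lt_of_le_of_lt (iSup₂_le fun a ha => ?_)
    (ENNReal.ofReal_lt_top (r := ‖(φ : MinTensor π →L[ℂ] ℂ)‖ * Fintype.card I))
  obtain ⟨z, hz⟩ := exists_norm_sub_smul_one_le π a
  rw [← ofReal_norm]
  refine ENNReal.ofReal_le_ofReal ?_
  have h1 : (φ : MinTensor π →L[ℂ] ℂ) a = (φ : MinTensor π →L[ℂ] ℂ) (a - z • 1) := by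
    rw [map_sub, φ.2 z, sub_zero]
  rw [h1]
  refine ((φ : MinTensor π →L[ℂ] ℂ).le_opNorm _).trans ?_
  gcongr
  refine hz.trans ((Finset.sum_le_card_nsmul _ _ 1 fun i _ =>
    (partialSeminorm_le_hammingSeminorm π i a).trans ha).trans ?_)
  simp

theorem dualNorm_partialSeminorm_lt_top (i : I) (ψ : tildePerp π i) :
    dualNorm π (partialSeminorm π i) ψ < ⊤ := by
  refine lt_of_le_of_lt (iSup₂_le fun a ha => ?_)
    (ENNReal.ofReal_lt_top (r := ‖((ψ : M0 π) : MinTensor π →L[ℂ] ℂ)‖))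
  obtain ⟨c, hc, hac⟩ := exists_tilde_norm_sub_lt π i a one_pos
  rw [← ofReal_norm]
  refine ENNReal.ofReal_le_ofReal ?_
  have h1 : ((ψ : M0 π) : MinTensor π →L[ℂ] ℂ) a =
      ((ψ : M0 π) : MinTensor π →L[ℂ] ℂ) (a - c) := by
    rw [map_sub, ψ.2 c hc, sub_zero]
  rw [h1]
  refine (ContinuousLinearMap.le_opNorm _ _).trans (mul_le_of_le_one_right (norm_nonneg _) ?_)
  linarith

theorem norm_apply_le_dualNorm_mul (φ : M0 π) (a : MinTensor π) :
    ‖(φ : MinTensor π →L[ℂ] ℂ) a‖ ≤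
      (dualNorm π (hammingSeminorm π) φ).toReal * hammingSeminorm π a := by
  have hfin := (dualNorm_hammingSeminorm_lt_top π φ).ne
  have unit : ∀ b, hammingSeminorm π b ≤ 1 →
      ‖(φ : MinTensor π →L[ℂ] ℂ) b‖ ≤ (dualNorm π (hammingSeminorm π) φ).toReal := fun b hb => by
    rw [← toReal_enorm]
    exact ENNReal.toReal_mono hfin (le_iSup₂ (f := fun (b : MinTensor π)
      (_ : hammingSeminorm π b ≤ 1) => ‖(φ : MinTensor π →L[ℂ] ℂ) b‖ₑ) b hb)
  refine le_of_forall_pos_le_add fun ε hε => ?_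
  set K := (dualNorm π (hammingSeminorm π) φ).toReal with hKdef
  have hK : 0 ≤ K := ENNReal.toReal_nonneg
  -- Scaling by a number slightly above `L_qH(a)` also covers `L_qH(a) = 0`; the increment costs at
  -- most `ε` after multiplication by `K`.
  set t := hammingSeminorm π a + ε / (K + 1) with ht
  have htpos : 0 < t := add_pos_of_nonneg_of_pos (hammingSeminorm_nonneg π a) (by positivity)
  have h1 := unit (((t⁻¹ : ℝ) : ℂ) • a) <| by
    rw [hammingSeminorm_smul, Complex.norm_real, norm_inv, Real.norm_of_nonneg htpos.le,
      inv_mul_le_one₀ htpos, ht]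
    exact le_add_of_nonneg_right (by positivity)
  rw [map_smul, norm_smul, Complex.norm_real, norm_inv, Real.norm_of_nonneg htpos.le,
    inv_mul_le_iff₀ htpos] at h1
  refine h1.trans ?_
  rw [ht, add_mul, mul_comm K]
  gcongr
  rw [div_mul_eq_mul_div, div_le_iff₀ (by positivity)]
  nlinarith

theorem dualNorm_sum_le (ψ : ∀ i, tildePerp π i) :
    dualNorm π (hammingSeminorm π) (∑ i, (ψ i : M0 π)) ≤
      ∑ i, dualNorm π (partialSeminorm π i) (ψ i) := by
  refine iSup₂_le fun a ha => ?_
  rw [Submodule.coe_sum, sum_apply]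
  refine (enorm_sum_le _ _).trans (Finset.sum_le_sum fun i _ => ?_)
  exact le_iSup₂ (f := fun (b : MinTensor π) (_ : partialSeminorm π i b ≤ 1) =>
    ‖((ψ i : M0 π) : MinTensor π →L[ℂ] ℂ) b‖ₑ) a
    ((partialSeminorm_le_hammingSeminorm π i a).trans ha)

/-- The infimum is attained, by the Hahn–Banach decomposition. -/
theorem exists_sum_dualNorm_le (φ : M0 π) :
    ∃ ψ : ∀ i, tildePerp π i, φ = ∑ i, (ψ i : M0 π) ∧
      ∑ i, dualNorm π (partialSeminorm π i) (ψ i) ≤ dualNorm π (hammingSeminorm π) φ := by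
  set K := (dualNorm π (hammingSeminorm π) φ).toReal with hKdef
  obtain ⟨ψ, hψ, hsum, hle⟩ := exists_decomposition
    (fun i => Subalgebra.toSubmodule (tilde π i).toSubalgebra) (φ : MinTensor π →L[ℂ] ℂ)
    (K := K * 2) (by positivity) fun a => by
      rw [mul_assoc, ← hammingSeminorm_eq]
      exact norm_apply_le_dualNorm_mul π φ a
  refine ⟨fun i => ⟨⟨ψ i, fun z => hψ i _ ((tilde π i).smul_mem (one_mem _) z)⟩, hψ i⟩, ?_, ?_⟩
  · refine Subtype.ext ?_
    rw [Submodule.coe_sum]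
    exact hsum
  · simp only [dualNorm, iSup_subtype']
    have : ∀ i, Nonempty {a : MinTensor π // partialSeminorm π i a ≤ 1} := fun i =>
      ⟨0, by rw [partialSeminorm_eq, map_zero, norm_zero]; norm_num⟩
    refine sum_iSup_le _ fun a => ?_
    -- The unit ball of `L_i` consists of the elements with quotient norm at most `1/2`, which
    -- cancels the factor in `K * 2`.
    have h1 : ∑ i, ‖ψ i (a i)‖ ≤ K := by
      refine (hle fun i => (a i : MinTensor π)).trans ?_
      rw [mul_assoc]
      refine mul_le_of_le_one_right ENNReal.toReal_nonneg ?_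
      rw [← le_div_iff₀' two_pos, pi_norm_le_iff_of_nonneg (by norm_num)]
      intro i
      rw [le_div_iff₀' two_pos, ← partialSeminorm_eq]
      exact (a i).2
    have h2 := ENNReal.ofReal_le_ofReal h1
    rw [ENNReal.ofReal_sum_of_nonneg fun i _ => norm_nonneg _, hKdef,
      ENNReal.ofReal_toReal (dualNorm_hammingSeminorm_lt_top π φ).ne] at h2
    simp only [ofReal_norm] at h2
    rw [dualNorm, iSup_subtype'] at h2
    exact h2

end Hamming

end QuantumHamming

theorem mainTheorem7 {I : Type*} [Fintype I] {A : I → Type*} [∀ i, CStarAlgebra (A i)]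
    {H : I → Type*} [∀ i, NormedAddCommGroup (H i)] [∀ i, InnerProductSpace ℂ (H i)]
    [∀ i, CompleteSpace (H i)] (π : ∀ i, A i →⋆ₐ[ℂ] (H i →L[ℂ] H i))
    (hπ : ∀ i, Function.Injective (π i)) (φ : QuantumHamming.M0 π) :
    QuantumHamming.dualNorm π (QuantumHamming.hammingSeminorm π) φ < ⊤ ∧
    (∀ (i : I) (ψ : QuantumHamming.tildePerp π i),
      QuantumHamming.dualNorm π (QuantumHamming.partialSeminorm π i) ψ < ⊤) ∧
    QuantumHamming.dualNorm π (QuantumHamming.hammingSeminorm π) φ =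
      ⨅ (ψ : ∀ i, QuantumHamming.tildePerp π i) (_ : φ = ∑ i, (ψ i : QuantumHamming.M0 π)),
        ∑ i, QuantumHamming.dualNorm π (QuantumHamming.partialSeminorm π i) (ψ i) := by
  refine ⟨QuantumHamming.dualNorm_hammingSeminorm_lt_top π φ, fun i ψ =>
    QuantumHamming.dualNorm_partialSeminorm_lt_top π i ψ,
    le_antisymm (le_iInf₂ fun ψ h => h ▸ QuantumHamming.dualNorm_sum_le π ψ) ?_⟩
  obtain ⟨ψ, hψ, hle⟩ := QuantumHamming.exists_sum_dualNorm_le π φ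
  exact (iInf₂_le ψ hψ).trans hle
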